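/- **Theorem.** Let $\mathbb F$ be a finite alphabet with $K$ elements (for instance the finite field $\mathbb F_K$), let $N_1,N_2\ge 2$ and $0\le P_1,P_2\le K-1$. Two entities $E_1,E_2$ hold sets $\mathcal P_1,\mathcal P_2\subseteq\mathbb F$, generated independently by including each element of $\mathbb F$ independently with probability $1/2$; $E_i$ replicates $\mathcal P_i$ on $N_i$ non-colluding databases. One of the entities, the initiator $E_i$, whose set has public size $|\mathcal P_i|=P_i$, queries the $N=N_j$ databases of the other entity $E_j$, as follows. The initiator has private randomness $\mathcal F$ and the databases of $E_j$ share a common randomness $S$; $\mathcal P_i$ (uniform among the sets of size $P_i$), $\mathcal F$, $\mathcal P_j$ (each element included independently with probability $1/2$) and $S$ are independent. For $n=1,\dots,N$ the $n$th query $Q_n$ is a function of $(\mathcal P_i,\mathcal F)$, and the $n$th answer $A_n$ is a string of $\ell_n$ bits, with $\ell_n$ fixed by the scheme, that is a function of $(Q_n,\mathcal P_j,S)$. A scheme is achievable if * (reliability) for every value of $\mathcal P_i$ of size $P_i$, the intersection $\mathcal P_1\cap\mathcal P_2$ is almost surely determined by $(\mathcal F,Q_{1:N},A_{1:N})$; *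 (initiator privacy) $I(\mathcal P_i;Q_n)=0$ for every $n$; * (responder privacy) for every value of $\mathcal P_i$ of size $P_i$, $I(\mathcal P_j\setminus\mathcal P_i\,;\,\mathcal F,Q_{1:N},A_{1:N})=0$, that is, the initiator learns nothing about which elements outside $\mathcal P_i$ belong to $\mathcal P_j$. Then the optimal download cost, the least over all achievable schemes initiated by either $E_1$ or $E_2$, is attained and equals $$D^*=\min\left\{\left\lceil\frac{P_1N_2}{N_2-1}\right\rceil,\ \left\lceil\frac{P_2N_1}{N_1-1}\right\rceil\right\}.$$ This holds both when the download cost is the total number of downloaded bits $D=\sum_{n=1}^{N}\ell_n$, and when it is the total answer entropy $D=\sum_{n=1}^{N}H(A_n)$ in bits, required to be a whole number. -/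

import Mathlib

open MeasureTheory ProbabilityTheory

namespace PSI

noncomputable section

/-! ### Information measures -/

/-- Shannon entropy, in bits, of a random variable `X` with finitely many values. -/
def entropy {Ω A : Type*} [MeasurableSpace Ω] [Fintype A] (μ : Measure Ω) (X : Ω → A) : ℝ :=
  (∑ a, Real.negMulLog (μ.real (X ⁻¹' {a}))) / Real.log 2

/-- Mutual information `I(X;Y)`: the Kullback-Leibler divergence between the joint law of `X`, `Y`
and the product of their laws. -/
def mutualInfo {Ω A B : Type*} [MeasurableSpace Ω] [MeasurableSpace A] [MeasurableSpace B]
    (μ : Measure Ω) (X : Ω → A) (Y : Ω → B) : ENNReal :=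
  InformationTheory.klDiv (μ.map fun ω => (X ω, Y ω)) ((μ.map X).prod (μ.map Y))

/-! ### The random sets -/

/-- The law of a random subset of the alphabet `𝔽` that contains each element of `𝔽`
independently with probability `1/2`. -/
def setLaw (𝔽 : Type) : Measure (Set 𝔽) :=
  setBernoulli Set.univ ⟨1 / 2, by norm_num, by norm_num⟩

/-- The law of such a random set given that its (public) cardinality is `p`. -/
def sizedSetLaw (𝔽 : Type) (p : ℕ) : Measure (Set 𝔽) :=
  cond (setLaw 𝔽) {P | P.ncard = p}

/-! ### Schemes

One entity (the initiator, with set `P`) queries the `N` databases of the other entity (the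
responder, with set `R`). -/

/-- A one-round retrieval scheme over the alphabet `𝔽` with `N` replicated databases at the
responder. -/
structure Scheme (𝔽 : Type) (N : ℕ) where
  /-- values of the private randomness `F` of the initiator -/
  UserRand : Type
  /-- values of the common randomness `S` shared by the databases of the responder -/
  CommonRand : Type
  /-- alphabet of the queries -/
  Query : Type
  [measurableSpaceUserRand : MeasurableSpace UserRand]
  [measurableSpaceCommonRand : MeasurableSpace CommonRand]
  [measurableSpaceQuery : MeasurableSpace Query]
  /-- law of `F` -/
  userLaw : Measure UserRand
  [isProbabilityMeasure_userLaw : IsProbabilityMeasure userLaw]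
  /-- law of `S` -/
  commonLaw : Measure CommonRand
  [isProbabilityMeasure_commonLaw : IsProbabilityMeasure commonLaw]
  /-- the query sent to the `n`th database, computed from the initiator's set and from `F` -/
  query : Fin N → Set 𝔽 → UserRand → Query
  measurable_query : ∀ n, Measurable fun x : Set 𝔽 × UserRand => query n x.1 x.2
  /-- the number of bits of the `n`th answer string -/
  len : Fin N → ℕ
  /-- the answer string of the `n`th database, computed from the query that it receives, from the
  responder's set and from `S` -/
  answer : ∀ n, Query → Set 𝔽 → CommonRand → (Fin (len n) → Bool)
  measurable_answer : ∀ n,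
    Measurable fun x : Query × Set 𝔽 × CommonRand => answer n x.1 x.2.1 x.2.2

namespace Scheme

attribute [instance] measurableSpaceUserRand measurableSpaceCommonRand measurableSpaceQuery
  isProbabilityMeasure_userLaw isProbabilityMeasure_commonLaw

variable {𝔽 : Type} {N : ℕ} (σ : Scheme 𝔽 N)

/-- An outcome `(F, R, S)` for a given set of the initiator: private randomness, responder's set,
common randomness. -/
abbrev Outcome : Type := σ.UserRand × Set 𝔽 × σ.CommonRand

/-- `F`, `R` and `S` are independent, and `R` contains each element with probability `1/2`. -/
def law : Measure σ.Outcome := σ.userLaw.prod ((setLaw 𝔽).prod σ.commonLaw)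

/-- The query received by the `n`th database when the initiator's set is `P`. -/
def Q (n : Fin N) (P : Set 𝔽) (ω : σ.Outcome) : σ.Query := σ.query n P ω.1

/-- The answer string of the `n`th database when the initiator's set is `P`. -/
def A (n : Fin N) (P : Set 𝔽) (ω : σ.Outcome) : Fin (σ.len n) → Bool :=
  σ.answer n (σ.Q n P ω) ω.2.1 ω.2.2

/-- Everything the initiator with set `P` sees: its private randomness, all queries and all
answer strings. -/
def view (P : Set 𝔽) (ω : σ.Outcome) :
    σ.UserRand × (Fin N → σ.Query) × (∀ n, Fin (σ.len n) → Bool) :=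
  (ω.1, fun n => σ.Q n P ω, fun n => σ.A n P ω)

/-- The joint law of the initiator's set, of public cardinality `p`, and of the independent
outcome `(F, R, S)`. -/
def jointLaw (p : ℕ) : Measure (Set 𝔽 × σ.Outcome) := (sizedSetLaw 𝔽 p).prod σ.law

/-- Reliability: whatever its set `P` of size `p`, the initiator computes `P ∩ R` without error
from what it sees. -/
def Reliable (p : ℕ) : Prop :=
  ∀ P : Set 𝔽, P.ncard = p →
    ∃ decode : σ.UserRand × (Fin N → σ.Query) × (∀ n, Fin (σ.len n) → Bool) → Set 𝔽,
      Measurable decode ∧ ∀ᵐ ω ∂σ.law, decode (σ.view P ω) = P ∩ ω.2.1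

/-- Privacy of the initiator: no single database of the responder learns anything about the
initiator's set from its query. -/
def InitiatorPrivate (p : ℕ) : Prop :=
  ∀ n : Fin N, mutualInfo (σ.jointLaw p) (fun x => x.1) (fun x => σ.Q n x.1 x.2) = 0

/-- Privacy of the responder: whatever its set `P` of size `p`, the initiator learns nothing about
which elements outside `P` belong to the responder's set. -/
def ResponderPrivate (p : ℕ) : Prop :=
  ∀ P : Set 𝔽, P.ncard = p → mutualInfo σ.law (fun ω => ω.2.1 \ P) (σ.view P) = 0

/-- The scheme is achievable for an initiator whose set has public cardinality `p`. -/
structure Achievable (p : ℕ) : Prop where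
  reliable : σ.Reliable p
  initiatorPrivate : σ.InitiatorPrivate p
  responderPrivate : σ.ResponderPrivate p

/-- The download cost as the total number of downloaded bits. -/
def bitCost : ℕ := ∑ n, σ.len n

/-- The download cost as the total entropy, in bits, of the answer strings. -/
def entropyCost (p : ℕ) : ℝ := ∑ n, entropy (σ.jointLaw p) fun x => σ.A n x.1 x.2

end Scheme

/-! ### Download costs of private set intersection

Either entity may initiate: entity 1 queries the `N₂` databases of entity 2, or conversely. -/

/-- The possible total numbers of downloaded bits. -/
def bitCosts (𝔽 : Type) (P₁ P₂ N₁ N₂ : ℕ) : Set ℕ :=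
  {D | (∃ σ : Scheme 𝔽 N₂, σ.Achievable P₁ ∧ σ.bitCost = D) ∨
    (∃ σ : Scheme 𝔽 N₁, σ.Achievable P₂ ∧ σ.bitCost = D)}

/-- The whole numbers that are the total answer entropy of an achievable scheme. -/
def entropyCosts (𝔽 : Type) (P₁ P₂ N₁ N₂ : ℕ) : Set ℕ :=
  {D | (∃ σ : Scheme 𝔽 N₂, σ.Achievable P₁ ∧ σ.entropyCost P₁ = D) ∨
    (∃ σ : Scheme 𝔽 N₁, σ.Achievable P₂ ∧ σ.entropyCost P₂ = D)}

end

end PSI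

/-!
Fix an initiator with a set of size `p` that queries `N` databases; the bound for each of the two
initiators separately gives the minimum.

**Converse.** Reliability lets the initiator with set `P` know `P ∩ R`, so responder privacy says
that `R \ P` is independent of what it sees even given `P ∩ R`. Hence the answer to a query made for
`P` has the same law for all `R` with the same trace on `P`. By initiator privacy the law of a query
does not depend on `P`, so the same holds for the trace on any other set of size `p`; as `p` is less
than the size of the alphabet, every element is missed by one of those sets, and a single answer is
independent of the whole of `R` (`PSI.Scheme.Achievable.answerProb_query_eq`). Given the set and the
private randomness of the initiator, `P ∩ R` is uniform with entropy `p` and determined by all the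
answers, so for each `n`
`p + H(A n) = H(P ∩ R, A n) ≤ H(A) ≤ ∑ m, H(A m)`.
Summing over `n` gives `N * p ≤ (N - 1) * ∑ m, H(A m)` (`PSI.mul_entropy_le_of_indep`). Averaging
over what was fixed only increases the entropies (`PSI.integral_entropy_le`), and `H(A n)` is at
most the number of bits of `A n`.

**Achievability.** The elements of `P` are split into `G = ⌈p / (N - 1)⌉` groups of at most `N - 1`
elements. For a group with common random bit `s` and a uniform key `h` in `𝔽₂^𝔽`, one database
returns the side information `s + ⟨h, R⟩`, and each of the others returns `s + ⟨h + e_x, R⟩` for one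
element `x` of the group: the difference of the two bits tells whether `x ∈ R`. Each query is
uniform, so initiator privacy holds; the view is a function of `h`, of `R ∩ P` and of the side
information, which is masked by `s`, so responder privacy holds. All the `p + G = ⌈p N / (N - 1)⌉`
downloaded bits at one database are masked by different bits of common randomness, so that each
answer is uniformly distributed and both download costs are `p + G`.
-/

namespace PSI

/-! ### Entropy of finitely valued random variables -/

/-- Gibbs' inequality. -/
lemma sum_negMulLog_le {A : Type*} [Fintype A] {p q : A → ℝ} (hp : ∀ a, 0 ≤ p a)
    (hq : ∀ a, 0 ≤ q a) (hsum : ∑ a, q a ≤ ∑ a, p a) (h0 : ∀ a, q a = 0 → p a = 0) :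
    ∑ a, Real.negMulLog (p a) ≤ -∑ a, p a * Real.log (q a) := by
  have key : ∀ a, Real.negMulLog (p a) + p a * Real.log (q a) ≤ q a - p a := by
    intro a
    rcases (hp a).eq_or_lt with h | h
    · simpa [← h] using hq a
    · have hq' : 0 < q a := (hq a).lt_of_ne fun h' => h.ne' (h0 a h'.symm)
      have h1 := Real.log_le_sub_one_of_pos (div_pos hq' h)
      rw [Real.log_div hq'.ne' h.ne'] at h1
      have h2 := mul_le_mul_of_nonneg_left h1 h.le
      have h3 : p a * (q a / p a - 1) = q a - p a := by field_simp
      rw [h3] at h2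
      simp only [Real.negMulLog]
      linarith
  have := Finset.sum_le_sum fun a (_ : a ∈ Finset.univ) => key a
  rw [Finset.sum_add_distrib, Finset.sum_sub_distrib] at this
  linarith

lemma measurableSet_preimage_pi_singleton {Ω ι : Type*} [MeasurableSpace Ω] [Countable ι]
    {C : ι → Type*} {X : ∀ i, Ω → C i} (hX : ∀ i c, MeasurableSet (X i ⁻¹' {c}))
    (c : ∀ i, C i) :
    MeasurableSet ((fun ω i => X i ω) ⁻¹' {c}) := by
  have : (fun ω i => X i ω) ⁻¹' {c} = ⋂ i, X i ⁻¹' {c i} := by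
    ext ω; simp [funext_iff]
  rw [this]
  exact .iInter fun i => hX i _

section

variable {Ω A B : Type*} [MeasurableSpace Ω] [Fintype B] {μ : Measure Ω}

lemma measureReal_preimage_comp [DecidableEq A] [IsFiniteMeasure μ] {Y : Ω → B} (g : B → A)
    (hY : ∀ b, MeasurableSet (Y ⁻¹' {b})) (a : A) :
    μ.real ((fun ω => g (Y ω)) ⁻¹' {a}) = ∑ b with g b = a, μ.real (Y ⁻¹' {b}) := by
  rw [sum_measureReal_preimage_singleton _ fun a _ => hY a]
  congr 1
  ext ω
  simp

variable [Fintype A]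

lemma sum_measureReal_preimage_singleton_eq_one [IsProbabilityMeasure μ] {X : Ω → A}
    (hX : ∀ a, MeasurableSet (X ⁻¹' {a})) : ∑ a, μ.real (X ⁻¹' {a}) = 1 := by
  rw [sum_measureReal_preimage_singleton _ fun a _ => hX a]
  simp

/-- Expectation of a function of `Y`, as a sum over the values of `Y`. -/
lemma sum_measureReal_preimage_comp_mul [IsFiniteMeasure μ] {Y : Ω → B} (g : B → A)
    (hY : ∀ b, MeasurableSet (Y ⁻¹' {b})) (φ : A → ℝ) :
    ∑ a, μ.real ((fun ω => g (Y ω)) ⁻¹' {a}) * φ a = ∑ b, μ.real (Y ⁻¹' {b}) * φ (g b) := by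
  classical
  simp_rw [measureReal_preimage_comp g hY, Finset.sum_mul]
  rw [← Finset.sum_fiberwise Finset.univ g]
  refine Finset.sum_congr rfl fun a _ => Finset.sum_congr rfl fun b hb => ?_
  rw [(Finset.mem_filter.1 hb).2]

/-- Data processing: a random variable that is almost surely a function of `Y` has at most the
entropy of `Y`. -/
lemma entropy_le_of_ae_eq_comp [IsFiniteMeasure μ] {X : Ω → A} {Y : Ω → B} (g : B → A)
    (h : ∀ᵐ ω ∂μ, X ω = g (Y ω)) (hY : ∀ b, MeasurableSet (Y ⁻¹' {b})) :
    entropy μ X ≤ entropy μ Y := by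
  classical
  unfold entropy
  refine div_le_div_of_nonneg_right ?_ (Real.log_nonneg one_le_two)
  have hX : ∀ a, μ.real (X ⁻¹' {a}) = μ.real ((fun ω => g (Y ω)) ⁻¹' {a}) := fun a => by
    refine measureReal_congr (Filter.eventuallyEq_set.2 ?_)
    filter_upwards [h] with ω hω
    simp [hω]
  simp_rw [hX]
  have h1 : ∀ a, Real.negMulLog (μ.real ((fun ω => g (Y ω)) ⁻¹' {a})) =
      μ.real ((fun ω => g (Y ω)) ⁻¹' {a}) *
        (-Real.log (μ.real ((fun ω => g (Y ω)) ⁻¹' {a}))) := fun a => by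
    rw [Real.negMulLog]; ring
  simp_rw [h1]
  rw [sum_measureReal_preimage_comp_mul g hY
    fun a => -Real.log (μ.real ((fun ω => g (Y ω)) ⁻¹' {a}))]
  refine Finset.sum_le_sum fun b _ => ?_
  rcases (measureReal_nonneg (μ := μ) (s := Y ⁻¹' {b})).eq_or_lt with h0 | h0
  · simp [← h0]
  · have : μ.real (Y ⁻¹' {b}) ≤ μ.real ((fun ω => g (Y ω)) ⁻¹' {g b}) :=
      measureReal_mono fun ω hω => by simp_all
    have := Real.log_le_log h0 this
    rw [Real.negMulLog]
    nlinarith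

lemma entropy_prodMk_of_indep [IsProbabilityMeasure μ] {X : Ω → A} {Y : Ω → B}
    (hX : ∀ a, MeasurableSet (X ⁻¹' {a})) (hY : ∀ b, MeasurableSet (Y ⁻¹' {b}))
    (h : ∀ a b, μ.real (X ⁻¹' {a} ∩ Y ⁻¹' {b}) = μ.real (X ⁻¹' {a}) * μ.real (Y ⁻¹' {b})) :
    entropy μ (fun ω => (X ω, Y ω)) = entropy μ X + entropy μ Y := by
  have h1 : ∀ a b, (fun ω => (X ω, Y ω)) ⁻¹' {(a, b)} = X ⁻¹' {a} ∩ Y ⁻¹' {b} := fun a b => by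
    ext ω; simp
  unfold entropy
  rw [← add_div, Fintype.sum_prod_type]
  simp_rw [h1, h, Real.negMulLog_mul, Finset.sum_add_distrib, ← Finset.sum_mul, ← Finset.mul_sum,
    ← Finset.sum_mul, sum_measureReal_preimage_singleton_eq_one hX,
    sum_measureReal_preimage_singleton_eq_one hY]
  simp

/-- Subadditivity of entropy. -/
lemma entropy_pi_le {ι : Type*} [Fintype ι] [DecidableEq ι] {C : ι → Type*}
    [∀ i, Fintype (C i)] [IsProbabilityMeasure μ] (X : ∀ i, Ω → C i)
    (hX : ∀ i c, MeasurableSet (X i ⁻¹' {c})) :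
    entropy μ (fun ω i => X i ω) ≤ ∑ i, entropy μ (X i) := by
  have hm := measurableSet_preimage_pi_singleton hX
  have hle : ∀ c i, μ.real ((fun ω i => X i ω) ⁻¹' {c}) ≤ μ.real (X i ⁻¹' {c i}) := fun c i =>
    measureReal_mono fun ω hω => by
      simp only [Set.mem_preimage, Set.mem_singleton_iff] at hω ⊢
      rw [← hω]
  unfold entropy
  rw [← Finset.sum_div]
  refine div_le_div_of_nonneg_right ?_ (Real.log_nonneg one_le_two)
  refine (sum_negMulLog_le (q := fun c => ∏ i, μ.real (X i ⁻¹' {c i}))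
    (fun c => measureReal_nonneg) (fun c => Finset.prod_nonneg fun i _ => measureReal_nonneg)
    ?_ ?_).trans ?_
  · rw [sum_measureReal_preimage_singleton_eq_one hm, ← Fintype.piFinset_univ,
      ← Finset.prod_univ_sum (fun i => (Finset.univ : Finset (C i)))
        fun i c => μ.real (X i ⁻¹' {c})]
    simp [sum_measureReal_preimage_singleton_eq_one (hX _)]
  · intro c hc
    obtain ⟨i, -, hi⟩ := Finset.prod_eq_zero_iff.1 hc
    exact le_antisymm ((hle c i).trans hi.le) measureReal_nonneg
  · have h1 : ∀ c, μ.real ((fun ω i => X i ω) ⁻¹' {c}) * Real.log (∏ i, μ.real (X i ⁻¹' {c i})) =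
        ∑ i, μ.real ((fun ω i => X i ω) ⁻¹' {c}) * Real.log (μ.real (X i ⁻¹' {c i})) := by
      intro c
      rcases (measureReal_nonneg (μ := μ) (s := (fun ω i => X i ω) ⁻¹' {c})).eq_or_lt with h | h
      · simp [← h]
      · rw [Real.log_prod fun i _ => (h.trans_le (hle c i)).ne', Finset.mul_sum]
    simp_rw [h1]
    rw [Finset.sum_comm, ← Finset.sum_neg_distrib]
    refine Finset.sum_le_sum fun i _ => ?_
    rw [← sum_measureReal_preimage_comp_mul (fun c : ∀ i, C i => c i) hm
      fun c => Real.log (μ.real (X i ⁻¹' {c})), ← Finset.sum_neg_distrib]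
    refine Finset.sum_le_sum fun c _ => ?_
    simp [Real.negMulLog]

lemma entropy_le_logb_card [IsProbabilityMeasure μ] [Nonempty A] {X : Ω → A}
    (hX : ∀ a, MeasurableSet (X ⁻¹' {a})) :
    entropy μ X ≤ Real.logb 2 (Fintype.card A) := by
  unfold entropy
  refine div_le_div_of_nonneg_right ?_ (Real.log_nonneg one_le_two)
  refine (sum_negMulLog_le (q := fun _ => (Fintype.card A : ℝ)⁻¹)
    (fun c => measureReal_nonneg) (fun c => by positivity) ?_ ?_).trans ?_
  · simp [sum_measureReal_preimage_singleton_eq_one hX]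
  · simp
  · rw [← Finset.sum_mul, sum_measureReal_preimage_singleton_eq_one hX]
    simp

/-- A random variable with `2 ^ k` equally likely values has entropy `k` bits. -/
lemma entropy_eq_of_uniform [IsProbabilityMeasure μ] {X : Ω → A}
    (hX : ∀ a, MeasurableSet (X ⁻¹' {a})) (k : ℕ)
    (h : ∀ a, μ.real (X ⁻¹' {a}) = 0 ∨ μ.real (X ⁻¹' {a}) = (2 ^ k)⁻¹) :
    entropy μ X = k := by
  have h1 : ∀ a, Real.negMulLog (μ.real (X ⁻¹' {a})) =
      μ.real (X ⁻¹' {a}) * (k * Real.log 2) := fun a => by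
    rcases h a with h | h <;> simp [h, Real.negMulLog]
  unfold entropy
  simp_rw [h1]
  rw [← Finset.sum_mul, sum_measureReal_preimage_singleton_eq_one hX, one_mul]
  exact mul_div_cancel_right₀ _ (Real.log_pos one_lt_two).ne'

end

/-- Conditioning does not increase entropy: a mixture has at least the average entropy of its
components. -/
lemma integral_entropy_le {α β A : Type*} [MeasurableSpace α] [MeasurableSpace β] [Fintype A]
    {μ : Measure α} [IsProbabilityMeasure μ] {ν : Measure β} [IsProbabilityMeasure ν]
    {X : α × β → A} (hX : ∀ a, MeasurableSet (X ⁻¹' {a})) :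
    Integrable (fun x => entropy ν fun y => X (x, y)) μ ∧
      ∫ x, entropy ν (fun y => X (x, y)) ∂μ ≤ entropy (μ.prod ν) X := by
  have hmeas : ∀ a, Measurable fun x => ν.real ((fun y => X (x, y)) ⁻¹' {a}) := fun a =>
    (measurable_measure_prodMk_left (hX a)).ennreal_toReal
  have hbd : ∀ a x, ν.real ((fun y => X (x, y)) ⁻¹' {a}) ∈ Set.Icc (0 : ℝ) 1 := fun a x =>
    ⟨measureReal_nonneg, measureReal_le_one⟩
  have hint : ∀ a, Integrable (fun x => ν.real ((fun y => X (x, y)) ⁻¹' {a})) μ := fun a =>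
    Integrable.of_mem_Icc 0 1 (hmeas a).aemeasurable (.of_forall (hbd a))
  have hint' : ∀ a, Integrable (fun x => Real.negMulLog (ν.real ((fun y => X (x, y)) ⁻¹' {a})))
      μ := fun a => by
    refine Integrable.of_mem_Icc 0 1
      (Real.continuous_negMulLog.measurable.comp (hmeas a)).aemeasurable
      (.of_forall fun x => ⟨Real.negMulLog_nonneg (hbd a x).1 (hbd a x).2, ?_⟩)
    rcases eq_or_ne (ν.real ((fun y => X (x, y)) ⁻¹' {a})) 1 with h | h
    · simp [h]
    · have := Real.negMulLog_lt_one_sub_self (hbd a x).1 h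
      linarith [(hbd a x).1]
  refine ⟨(integrable_finsetSum _ fun a _ => hint' a).div_const _, ?_⟩
  unfold entropy
  rw [integral_div, integral_finsetSum _ fun a _ => hint' a]
  refine div_le_div_of_nonneg_right (Finset.sum_le_sum fun a _ => ?_)
    (Real.log_nonneg one_le_two)
  have h1 : (μ.prod ν).real (X ⁻¹' {a}) = ∫ x, ν.real ((fun y => X (x, y)) ⁻¹' {a}) ∂μ := by
    rw [measureReal_def, Measure.prod_apply (hX a), ← integral_toReal
      (measurable_measure_prodMk_left (hX a)).aemeasurable (.of_forall fun x => measure_lt_top _ _)]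
    rfl
  rw [h1]
  exact Real.concaveOn_negMulLog.le_map_integral Real.continuous_negMulLog.continuousOn
    isClosed_Ici (.of_forall fun x => (hbd a x).1) (hint a) (hint' a)

/-! ### Independence -/

section

variable {Ω A B : Type*} [MeasurableSpace Ω] [MeasurableSpace A] [MeasurableSpace B]
  {μ : Measure Ω} [IsProbabilityMeasure μ] {X : Ω → A} {Y : Ω → B}

lemma mutualInfo_eq_zero_iff (hX : Measurable X) (hY : Measurable Y) :
    mutualInfo μ X Y = 0 ↔ IndepFun X Y μ := by
  have := Measure.isProbabilityMeasure_map (μ := μ) hX.aemeasurable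
  have := Measure.isProbabilityMeasure_map (μ := μ) hY.aemeasurable
  have := Measure.isProbabilityMeasure_map (μ := μ) (hX.prodMk hY).aemeasurable
  rw [mutualInfo, InformationTheory.klDiv_eq_zero_iff,
    indepFun_iff_map_prod_eq_prod_map_map' hX.aemeasurable hY.aemeasurable inferInstance
      inferInstance]

end

/-! ### The uniformly random set -/

section

variable {𝔽 : Type}

instance : IsProbabilityMeasure (setLaw 𝔽) := by unfold setLaw; infer_instance

variable [Fintype 𝔽]

lemma setLaw_singleton (r : Set 𝔽) : setLaw 𝔽 {r} = (2 ^ Fintype.card 𝔽)⁻¹ := by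
  have h : (setLaw 𝔽).real {r} = (2 ^ Fintype.card 𝔽)⁻¹ := by
    rw [setLaw, setBernoulli_real_singleton _ (Set.subset_univ r) Set.finite_univ]
    norm_num
    rw [← pow_add, ← Set.ncard_union_eq Set.disjoint_sdiff_right (Set.toFinite _) (Set.toFinite _)]
    simp [Set.ncard_univ]
  rw [← ENNReal.toReal_eq_toReal_iff' (by finiteness) (by simp), ← measureReal_def, h]
  simp

lemma setLaw_apply (S : Set (Set 𝔽)) : setLaw 𝔽 S = S.ncard * (2 ^ Fintype.card 𝔽)⁻¹ := by
  rw [← Set.Finite.coe_toFinset (Set.toFinite S), ← sum_measure_singleton, Set.ncard_coe_finset]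
  simp [setLaw_singleton]

/-- The trace of the random set on `T` is a uniformly random subset of `T`. -/
lemma setLaw_inter_eq {T x : Set 𝔽} (hx : x ⊆ T) :
    setLaw 𝔽 {r | r ∩ T = x} = (2 ^ T.ncard)⁻¹ := by
  have h : {r | r ∩ T = x} = (x ∪ ·) '' 𝒫 Tᶜ := by
    ext r
    simp only [Set.mem_ofPred_eq, Set.mem_image, Set.mem_powerset_iff]
    constructor
    · rintro rfl
      exact ⟨r \ T, fun y hy => hy.2, Set.inter_union_sdiff r T⟩
    · rintro ⟨y, hy, rfl⟩
      rw [Set.union_inter_distrib_right, Set.inter_eq_left.2 hx,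
        Set.disjoint_iff_inter_eq_empty.1 (Set.disjoint_left.2 hy), Set.union_empty]
  have hinj : Set.InjOn (x ∪ ·) (𝒫 Tᶜ) := fun y hy z hz hyz => by
    have : ∀ w ∈ 𝒫 Tᶜ, (x ∪ w) \ T = w := fun w hw => by
      rw [Set.union_sdiff_distrib, Set.sdiff_eq_empty.2 hx, Set.empty_union]
      exact sdiff_eq_left.2 (Set.disjoint_left.2 hw)
    rw [← this y hy, ← this z hz]
    exact congrArg (· \ T) hyz
  have hcard : Fintype.card 𝔽 = Tᶜ.ncard + T.ncard := by
    rw [add_comm, Set.ncard_add_ncard_compl, Nat.card_eq_fintype_card]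
  rw [setLaw_apply, h, hinj.ncard_image, Set.ncard_powerset _ (Set.toFinite _), hcard,
    pow_add, ENNReal.mul_inv (by simp) (by simp), ← mul_assoc]
  push_cast
  rw [ENNReal.mul_inv_cancel (by simp) (by simp), one_mul]

/-- The parts of the random set inside and outside `T` are independent. -/
lemma indepFun_sdiff_inter (T : Set 𝔽) :
    IndepFun (fun r : Set 𝔽 => r \ T) (fun r => r ∩ T) (setLaw 𝔽) := by
  rw [indepFun_iff_map_prod_eq_prod_map_map' (by fun_prop) (by fun_prop) inferInstance
    inferInstance]
  refine Measure.ext_of_singleton fun ⟨x, y⟩ => ?_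
  rw [← Set.singleton_prod_singleton, Measure.prod_prod,
    Measure.map_apply (by fun_prop) (.of_discrete), Measure.map_apply (by fun_prop) (.of_discrete),
    Measure.map_apply (by fun_prop) (.of_discrete)]
  have hx : (fun r : Set 𝔽 => r \ T) ⁻¹' {x} = {r | r ∩ Tᶜ = x} := rfl
  have hy : (fun r : Set 𝔽 => r ∩ T) ⁻¹' {y} = {r | r ∩ T = y} := rfl
  rw [Set.mk_preimage_prod, hx, hy]
  by_cases hxT : x ⊆ Tᶜ
  swap
  · have : {r | r ∩ Tᶜ = x} = ∅ := by
      refine Set.eq_empty_of_forall_notMem ?_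
      rintro r rfl
      exact hxT Set.inter_subset_right
    simp [this]
  by_cases hyT : y ⊆ T
  swap
  · have : {r | r ∩ T = y} = ∅ := by
      refine Set.eq_empty_of_forall_notMem ?_
      rintro r rfl
      exact hyT Set.inter_subset_right
    simp [this]
  have hxy : {r | r ∩ Tᶜ = x} ∩ {r | r ∩ T = y} = {x ∪ y} := by
    ext r
    simp only [Set.mem_inter_iff, Set.mem_ofPred_eq, Set.mem_singleton_iff]
    constructor
    · rintro ⟨rfl, rfl⟩
      rw [← Set.inter_union_distrib_left, Set.compl_union_self, Set.inter_univ]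
    · rintro rfl
      have h1 := Set.disjoint_iff_inter_eq_empty.1 (Set.disjoint_left.2 hxT)
      rw [Set.union_inter_distrib_right, Set.union_inter_distrib_right, Set.inter_eq_left.2 hxT,
        Set.inter_eq_left.2 hyT, h1]
      have h2 : y ∩ Tᶜ = ∅ := by
        rw [← Set.disjoint_iff_inter_eq_empty, Set.disjoint_compl_right_iff_subset]
        exact hyT
      simp [h2]
  have hcard : Fintype.card 𝔽 = Tᶜ.ncard + T.ncard := by
    rw [add_comm, Set.ncard_add_ncard_compl, Nat.card_eq_fintype_card]
  rw [hxy, setLaw_singleton, setLaw_inter_eq hxT, setLaw_inter_eq hyT, hcard, pow_add,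
    ENNReal.mul_inv (by simp) (by simp)]

variable {p : ℕ}

lemma measure_ncard_eq_ne_zero (hp : p < Fintype.card 𝔽) :
    setLaw 𝔽 {P | P.ncard = p} ≠ 0 := by
  obtain ⟨P, -, hP⟩ := Set.exists_subset_card_eq (s := (Set.univ : Set 𝔽)) (n := p)
    (by rw [Set.ncard_univ, Nat.card_eq_fintype_card]; exact hp.le)
  refine fun h => ?_
  have := measure_mono_null (Set.singleton_subset_iff.2 (show P ∈ {P | P.ncard = p} from hP)) h
  simp [setLaw_singleton] at this

lemma isProbabilityMeasure_sizedSetLaw (hp : p < Fintype.card 𝔽) :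
    IsProbabilityMeasure (sizedSetLaw 𝔽 p) :=
  cond_isProbabilityMeasure (measure_ncard_eq_ne_zero hp)

lemma sizedSetLaw_singleton_ne_zero {P : Set 𝔽} (hP : P.ncard = p) :
    sizedSetLaw 𝔽 p {P} ≠ 0 := by
  rw [sizedSetLaw, cond_apply .of_discrete,
    Set.inter_eq_right.2 (Set.singleton_subset_iff.2 (show P ∈ {P | P.ncard = p} from hP))]
  simp [setLaw_singleton]

lemma ae_sizedSetLaw_ncard_eq : ∀ᵐ P ∂sizedSetLaw 𝔽 p, P.ncard = p :=
  ae_cond_mem .of_discrete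

end

/-! ### Converse -/

/-- If each of the variables `Y i` alone is independent of `X`, but all of them together determine
`X`, then their total entropy is at least `N / (N - 1)` times the entropy of `X`: for each `i`,
`H(X) + H(Y i) = H(X, Y i) ≤ H(Y) ≤ ∑ j, H(Y j)`. -/
lemma mul_entropy_le_of_indep {Ω A ι : Type*} [MeasurableSpace Ω] {μ : Measure Ω}
    [IsProbabilityMeasure μ] [Fintype A] [Fintype ι] [DecidableEq ι] {C : ι → Type*}
    [∀ i, Fintype (C i)] {X : Ω → A} {Y : ∀ i, Ω → C i}
    (hX : ∀ a, MeasurableSet (X ⁻¹' {a})) (hY : ∀ i c, MeasurableSet (Y i ⁻¹' {c}))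
    (g : (∀ i, C i) → A) (hg : ∀ᵐ ω ∂μ, X ω = g fun i => Y i ω)
    (h : ∀ i a c, μ.real (X ⁻¹' {a} ∩ Y i ⁻¹' {c}) = μ.real (X ⁻¹' {a}) * μ.real (Y i ⁻¹' {c})) :
    Fintype.card ι * entropy μ X ≤ (Fintype.card ι - 1) * ∑ i, entropy μ (Y i) := by
  have key : ∀ i, entropy μ X + entropy μ (Y i) ≤ ∑ j, entropy μ (Y j) := fun i => by
    rw [← entropy_prodMk_of_indep hX (hY i) (h i)]
    refine (entropy_le_of_ae_eq_comp (fun c => (g c, c i)) ?_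
      (measurableSet_preimage_pi_singleton hY)).trans (entropy_pi_le Y hY)
    filter_upwards [hg] with ω hω
    rw [hω]
  have := Finset.sum_le_sum fun i (_ : i ∈ Finset.univ) => key i
  simp only [Finset.sum_add_distrib, Finset.sum_const, Finset.card_univ, nsmul_eq_mul] at this
  linarith

namespace Scheme

variable {𝔽 : Type} {N : ℕ} (σ : Scheme 𝔽 N) {p : ℕ} {n : Fin N}

instance isProbabilityMeasure_law : IsProbabilityMeasure σ.law := by unfold law; infer_instance

lemma isProbabilityMeasure_jointLaw [Fintype 𝔽] (hp : p < Fintype.card 𝔽) :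
    IsProbabilityMeasure (σ.jointLaw p) := by
  have := isProbabilityMeasure_sizedSetLaw hp
  unfold jointLaw
  infer_instance

lemma measurable_Q_joint (n : Fin N) :
    Measurable fun x : Set 𝔽 × σ.Outcome => σ.Q n x.1 x.2 :=
  (σ.measurable_query n).comp (measurable_fst.prodMk measurable_snd.fst)

lemma measurable_query_right (n : Fin N) (P : Set 𝔽) : Measurable (σ.query n P) :=
  (σ.measurable_query n).comp measurable_prodMk_left

lemma measurable_A_joint (n : Fin N) :
    Measurable fun x : Set 𝔽 × σ.Outcome => σ.A n x.1 x.2 :=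
  (σ.measurable_answer n).comp ((σ.measurable_Q_joint n).prodMk measurable_snd.snd)

lemma measurable_view (P : Set 𝔽) : Measurable (σ.view P) :=
  measurable_fst.prodMk ((measurable_pi_lambda _ fun n =>
    (σ.measurable_Q_joint n).comp measurable_prodMk_left).prodMk
    (measurable_pi_lambda _ fun n => (σ.measurable_A_joint n).comp measurable_prodMk_left))

/-- The probability, over the common randomness, that the `n`th database holding the set `r`
answers `a` to the query `q`. -/
noncomputable def answerProb (n : Fin N) (a : Fin (σ.len n) → Bool) (r : Set 𝔽) (q : σ.Query) :
    ENNReal :=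
  σ.commonLaw {s | σ.answer n q r s = a}

variable {σ}

lemma measurable_answerProb (a : Fin (σ.len n) → Bool) (r : Set 𝔽) :
    Measurable (σ.answerProb n a r) :=
  measurable_measure_prodMk_left (((σ.measurable_answer n).comp
    (measurable_fst.prodMk (measurable_const.prodMk measurable_snd))) (measurableSet_singleton a))

variable [Fintype 𝔽]

/-- By initiator privacy, the law of a query does not depend on the set of the initiator. -/
lemma InitiatorPrivate.map_query_eq (h : σ.InitiatorPrivate p) (hp : p < Fintype.card 𝔽)
    {P P' : Set 𝔽} (hP : P.ncard = p) (hP' : P'.ncard = p) (n : Fin N) :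
    σ.userLaw.map (σ.query n P) = σ.userLaw.map (σ.query n P') := by
  have := σ.isProbabilityMeasure_jointLaw hp
  have := isProbabilityMeasure_sizedSetLaw hp
  have hind := (mutualInfo_eq_zero_iff measurable_fst (σ.measurable_Q_joint n)).1 (h n)
  rw [indepFun_iff_measure_inter_preimage_eq_mul] at hind
  have key : ∀ P : Set 𝔽, P.ncard = p → ∀ B, MeasurableSet B →
      σ.userLaw.map (σ.query n P) B =
        σ.jointLaw p ((fun x => σ.Q n x.1 x.2) ⁻¹' B) := by
    intro P hP B hB
    have h1 := hind {P} B (measurableSet_singleton P) hB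
    have e1 : (Prod.fst ⁻¹' {P} ∩ (fun x : Set 𝔽 × σ.Outcome => σ.Q n x.1 x.2) ⁻¹' B) =
        {P} ×ˢ ((σ.query n P ⁻¹' B) ×ˢ Set.univ) := by
      ext ⟨P', f, y⟩
      simp only [Q, Set.mem_inter_iff, Set.mem_preimage, Set.mem_singleton_iff, Set.mem_prod,
        Set.mem_univ, and_true]
      constructor <;> rintro ⟨rfl, h⟩ <;> exact ⟨rfl, h⟩
    have e2 : (Prod.fst ⁻¹' {P} : Set (Set 𝔽 × σ.Outcome)) = {P} ×ˢ Set.univ := by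
      ext; simp
    rw [e1, e2, jointLaw, law, Measure.prod_prod, Measure.prod_prod, Measure.prod_prod,
      measure_univ, measure_univ, mul_one, mul_one] at h1
    rw [Measure.map_apply (σ.measurable_query_right n P) hB]
    exact (ENNReal.mul_right_inj (sizedSetLaw_singleton_ne_zero hP) (measure_ne_top _ _)).1 h1
  ext B hB
  rw [key P hP B hB, key P' hP' B hB]

/-- Responder privacy and reliability: the answer to a query made for the set `P` reveals nothing
about the responder's set outside `P`. Reliability makes the elements inside `P` known, so that
responder privacy also holds conditionally on them. -/
lemma Achievable.answerProb_query_eq_of_inter_eq (h : σ.Achievable p) {P : Set 𝔽}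
    (hP : P.ncard = p) (a : Fin (σ.len n) → Bool) {r r' : Set 𝔽} (hr : P ∩ r = P ∩ r') :
    ∀ᵐ f ∂σ.userLaw, σ.answerProb n a r (σ.query n P f) =
      σ.answerProb n a r' (σ.query n P f) := by
  obtain ⟨decode, hdm, hd⟩ := h.reliable P hP
  have hind := (mutualInfo_eq_zero_iff (by fun_prop) (σ.measurable_view P)).1
    (h.responderPrivate P hP)
  rw [indepFun_iff_measure_inter_preimage_eq_mul] at hind
  have hmeas : ∀ r, Measurable fun f => σ.answerProb n a r (σ.query n P f) := fun r =>
    (measurable_answerProb a r).comp (σ.measurable_query_right n P)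
  have h1 : ∀ (r : Set 𝔽) (B : Set σ.UserRand), MeasurableSet B →
      σ.law {ω | ω.1 ∈ B ∧ σ.A n P ω = a ∧ ω.2.1 = r} =
        setLaw 𝔽 {r} * ∫⁻ f in B, σ.answerProb n a r (σ.query n P f) ∂σ.userLaw := by
    intro r B hB
    have hm : MeasurableSet {ω : σ.Outcome | ω.1 ∈ B ∧ σ.A n P ω = a ∧ ω.2.1 = r} :=
      (measurable_fst hB).inter (((σ.measurable_A_joint n).comp measurable_prodMk_left
        (measurableSet_singleton a)).inter (measurable_snd.fst (measurableSet_singleton r)))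
    rw [law, Measure.prod_apply hm, ← lintegral_const_mul _ (hmeas r), ← lintegral_indicator hB]
    refine lintegral_congr fun f => ?_
    by_cases hf : f ∈ B
    · rw [Set.indicator_of_mem hf, answerProb, ← Measure.prod_prod]
      congr 1
      ext ⟨r', s⟩
      simp only [A, Q, hf, true_and, Set.mem_preimage, Set.mem_ofPred_eq, Set.mem_prod,
        Set.mem_singleton_iff]
      constructor
      · rintro ⟨h, rfl⟩; exact ⟨rfl, h⟩
      · rintro ⟨rfl, h⟩; exact ⟨h, rfl⟩
    · rw [Set.indicator_of_notMem hf]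
      simp [hf]
  have h2 : ∀ (r : Set 𝔽) (B : Set σ.UserRand), MeasurableSet B →
      σ.law {ω | ω.1 ∈ B ∧ σ.A n P ω = a ∧ ω.2.1 = r} =
        (2 ^ Pᶜ.ncard)⁻¹ * σ.law {ω | ω.1 ∈ B ∧ σ.A n P ω = a ∧ decode (σ.view P ω) = P ∩ r} := by
    intro r B hB
    have hV : MeasurableSet {v : σ.UserRand × (Fin N → σ.Query) × (∀ n, Fin (σ.len n) → Bool) |
        v.1 ∈ B ∧ v.2.2 n = a ∧ decode v = P ∩ r} :=
      (measurable_fst hB).inter ((measurableSet_eq_fun (by fun_prop) measurable_const).inter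
        (measurableSet_eq_fun hdm measurable_const))
    have h3 := hind {r \ P} _ (measurableSet_singleton _) hV
    have e1 : σ.law ((fun ω => ω.2.1 \ P) ⁻¹' {r \ P}) = (2 ^ Pᶜ.ncard)⁻¹ := by
      rw [← setLaw_inter_eq (T := Pᶜ) (x := r \ P) fun x hx => hx.2]
      have : ((fun ω : σ.Outcome => ω.2.1 \ P) ⁻¹' {r \ P}) =
          Set.univ ×ˢ ({r' | r' ∩ Pᶜ = r \ P} ×ˢ Set.univ) := by
        ext ⟨f, r', s⟩; simp [Set.sdiff_eq]
      rw [this, law, Measure.prod_prod, Measure.prod_prod]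
      simp
    rw [e1] at h3
    refine Eq.trans (measure_congr (Filter.eventuallyEq_set.2 ?_)) h3
    filter_upwards [hd] with ω hω
    simp only [Set.mem_inter_iff, Set.mem_preimage, Set.mem_singleton_iff, Set.mem_ofPred_eq, hω]
    constructor
    · rintro ⟨hB, hA, rfl⟩
      exact ⟨rfl, hB, hA, rfl⟩
    · rintro ⟨h1, hB, hA, h2⟩
      refine ⟨hB, hA, ?_⟩
      rw [← Set.inter_union_sdiff ω.2.1 P, ← Set.inter_union_sdiff r P, h1, Set.inter_comm _ P, h2,
        Set.inter_comm P]
  refine ae_eq_of_forall_setLIntegral_eq_of_sigmaFinite (hmeas r) (hmeas r') fun B hB _ => ?_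
  have h3 := (h1 r B hB).symm.trans (h2 r B hB)
  rw [hr, ← h2 r' B hB, h1 r' B hB, setLaw_singleton, setLaw_singleton] at h3
  exact (ENNReal.mul_right_inj (by simp) (by simp)).1 h3

/-- The answer to a query is independent of the whole set of the responder. Indeed each element
lies outside some admissible set `P'` of the initiator, so that an answer to a query made for `P'`
says nothing about it; and a single database cannot tell such queries from those made for `P`. -/
lemma Achievable.answerProb_query_eq (h : σ.Achievable p) (hp : p < Fintype.card 𝔽) {P : Set 𝔽}
    (hP : P.ncard = p) (n : Fin N) :
    ∀ᵐ f ∂σ.userLaw, ∀ (a : Fin (σ.len n) → Bool) (r : Set 𝔽),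
      σ.answerProb n a r (σ.query n P f) = σ.answerProb n a ∅ (σ.query n P f) := by
  have key : ∀ (a : Fin (σ.len n) → Bool) (i : 𝔽) (r : Set 𝔽), ∀ᵐ f ∂σ.userLaw,
      σ.answerProb n a (insert i r) (σ.query n P f) = σ.answerProb n a r (σ.query n P f) := by
    intro a i r
    obtain ⟨P', hiP', hP'⟩ := Set.exists_subset_card_eq (s := ({i}ᶜ : Set 𝔽)) (n := p) (by
      have := Set.ncard_add_ncard_compl ({i} : Set 𝔽)
      rw [Set.ncard_singleton, Nat.card_eq_fintype_card] at this
      omega)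
    have h1 : ∀ᵐ f ∂σ.userLaw, σ.answerProb n a (insert i r) (σ.query n P' f) =
        σ.answerProb n a r (σ.query n P' f) := by
      refine h.answerProb_query_eq_of_inter_eq hP' a (Set.inter_insert_of_notMem ?_)
      exact fun hi => hiP' hi rfl
    have hm : MeasurableSet {q | σ.answerProb n a (insert i r) q = σ.answerProb n a r q} :=
      measurableSet_eq_fun (measurable_answerProb a _) (measurable_answerProb a _)
    rw [← ae_map_iff (p := fun q => σ.answerProb n a (insert i r) q = σ.answerProb n a r q)
      (σ.measurable_query_right n P').aemeasurable hm,
      h.initiatorPrivate.map_query_eq hp hP' hP,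
      ae_map_iff (σ.measurable_query_right n P).aemeasurable hm] at h1
    exact h1
  simp_rw [← ae_all_iff] at key
  filter_upwards [key] with f hf a r
  induction r, Set.toFinite r using Set.Finite.induction_on with
  | empty => rfl
  | insert _ _ ih => rw [hf, ih]

/-- The bound on the answer entropies, for a given set and given private randomness of the
initiator. -/
lemma Achievable.mul_le_sum_entropy (h : σ.Achievable p) (hp : p < Fintype.card 𝔽) {P : Set 𝔽}
    (hP : P.ncard = p) :
    ∀ᵐ f ∂σ.userLaw, (N * p : ℝ) ≤ (N - 1) * ∑ n, entropy ((setLaw 𝔽).prod σ.commonLaw)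
      fun y => σ.answer n (σ.query n P f) y.1 y.2 := by
  obtain ⟨decode, hdm, hd⟩ := h.reliable P hP
  filter_upwards [ae_all_iff.2 fun n => h.answerProb_query_eq hp hP n,
    Measure.ae_ae_of_ae_prod hd] with f hf hd'
  have hR : ∀ x, (setLaw 𝔽).prod σ.commonLaw ((fun y => y.1 ∩ P) ⁻¹' {x}) =
      setLaw 𝔽 {r | r ∩ P = x} := fun x => by
    have : ((fun y : Set 𝔽 × σ.CommonRand => y.1 ∩ P) ⁻¹' {x}) =
        {r | r ∩ P = x} ×ˢ Set.univ := by ext; simp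
    rw [this, Measure.prod_prod, measure_univ, mul_one]
  have hmR : ∀ x, MeasurableSet ((fun y : Set 𝔽 × σ.CommonRand => y.1 ∩ P) ⁻¹' {x}) := fun x =>
    (show Measurable fun y : Set 𝔽 × σ.CommonRand => y.1 ∩ P by fun_prop)
      (measurableSet_singleton x)
  have hmA : ∀ n a, MeasurableSet
      ((fun y : Set 𝔽 × σ.CommonRand => σ.answer n (σ.query n P f) y.1 y.2) ⁻¹' {a}) := fun n a =>
    ((σ.measurable_answer n).comp (measurable_const.prodMk measurable_id))
      (measurableSet_singleton a)
  -- the joint law of the responder's set and of one answer is a product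
  have hSA : ∀ n a (S : Set (Set 𝔽)), (setLaw 𝔽).prod σ.commonLaw
      ((fun y => y.1) ⁻¹' S ∩ (fun y => σ.answer n (σ.query n P f) y.1 y.2) ⁻¹' {a}) =
        setLaw 𝔽 S * σ.answerProb n a ∅ (σ.query n P f) := fun n a S => by
    rw [Measure.prod_apply ((measurable_fst .of_discrete).inter (hmA n a)), mul_comm,
      ← setLIntegral_const, ← lintegral_indicator .of_discrete]
    refine lintegral_congr fun r => ?_
    by_cases hr : r ∈ S
    · rw [Set.indicator_of_mem hr, ← hf n a r, answerProb]
      congr 1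
      ext s
      simp [hr]
    · rw [Set.indicator_of_notMem hr]
      refine measure_mono_null (fun s hs => ?_) measure_empty
      exact hr hs.1
  have hH : entropy ((setLaw 𝔽).prod σ.commonLaw) (fun y => y.1 ∩ P) = p := by
    refine entropy_eq_of_uniform hmR p fun x => ?_
    rw [measureReal_def, hR]
    by_cases hx : x ⊆ P
    · right
      rw [setLaw_inter_eq hx, hP]
      simp
    · left
      have : {r | r ∩ P = x} = ∅ := by
        refine Set.eq_empty_of_forall_notMem ?_
        rintro r rfl
        exact hx Set.inter_subset_right
      simp [this]
  have hdet : ∀ᵐ y ∂(setLaw 𝔽).prod σ.commonLaw, y.1 ∩ P =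
      decode (f, (fun n => σ.query n P f), fun n => σ.answer n (σ.query n P f) y.1 y.2) := by
    filter_upwards [hd'] with y hy
    rw [Set.inter_comm]
    exact hy.symm
  have := mul_entropy_le_of_indep hmR hmA
    (fun A => decode (f, (fun n => σ.query n P f), A)) hdet fun n x a => by
      have h1 := hSA n a {r | r ∩ P = x}
      have h2 := hSA n a Set.univ
      rw [Set.preimage_univ, Set.univ_inter, measure_univ, one_mul] at h2
      simp only [measureReal_def]
      rw [← ENNReal.toReal_mul, hR, h2, ← h1]
      rfl
  rwa [hH, Fintype.card_fin] at this

theorem Achievable.mul_le_entropyCost (h : σ.Achievable p) (hp : p < Fintype.card 𝔽)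
    (hN : 1 ≤ N) : (N * p : ℝ) ≤ (N - 1) * σ.entropyCost p := by
  have := isProbabilityMeasure_sizedSetLaw hp
  have hXm : ∀ n, Measurable fun x : (Set 𝔽 × σ.UserRand) × Set 𝔽 × σ.CommonRand =>
      σ.answer n (σ.query n x.1.1 x.1.2) x.2.1 x.2.2 := fun n =>
    (σ.measurable_answer n).comp
      (((σ.measurable_query n).comp measurable_fst).prodMk measurable_snd)
  have hint := fun n => integral_entropy_le (μ := (sizedSetLaw 𝔽 p).prod σ.userLaw)
    (ν := (setLaw 𝔽).prod σ.commonLaw) fun a => hXm n (measurableSet_singleton a)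
  have hH : ∀ n, entropy (((sizedSetLaw 𝔽 p).prod σ.userLaw).prod
      ((setLaw 𝔽).prod σ.commonLaw))
      (fun x => σ.answer n (σ.query n x.1.1 x.1.2) x.2.1 x.2.2) =
        entropy (σ.jointLaw p) fun x => σ.A n x.1 x.2 := fun n => by
    have hmp := measurePreserving_prodAssoc (sizedSetLaw 𝔽 p) σ.userLaw
      ((setLaw 𝔽).prod σ.commonLaw)
    unfold entropy
    congr 1
    refine Finset.sum_congr rfl fun a _ => ?_
    rw [jointLaw, law, measureReal_def, measureReal_def, ← hmp.measure_preimage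
      ((σ.measurable_A_joint n) (measurableSet_singleton a)).nullMeasurableSet]
    rfl
  have hae : ∀ᵐ x ∂(sizedSetLaw 𝔽 p).prod σ.userLaw, (N * p : ℝ) ≤ (N - 1) *
      ∑ n, entropy ((setLaw 𝔽).prod σ.commonLaw)
        fun y => σ.answer n (σ.query n x.1 x.2) y.1 y.2 := by
    refine (Measure.ae_prod_iff_ae_ae ?_).2 ?_
    · refine measurableSet_le measurable_const (measurable_const.mul
        (Finset.measurable_fun_sum _ fun n _ => ?_))
      unfold entropy
      refine (Finset.measurable_fun_sum _ fun a _ => ?_).div_const _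
      exact Real.continuous_negMulLog.measurable.comp (measurable_measure_prodMk_left
        (hXm n (measurableSet_singleton a))).ennreal_toReal
    · filter_upwards [ae_sizedSetLaw_ncard_eq] with P hP
      exact h.mul_le_sum_entropy hp hP
  have h1 := integral_mono_ae (integrable_const _)
    ((integrable_finsetSum _ fun n _ => (hint n).1).const_mul _) hae
  rw [integral_const, probReal_univ, one_smul, integral_const_mul,
    integral_finsetSum _ fun n _ => (hint n).1] at h1
  refine h1.trans (mul_le_mul_of_nonneg_left (Finset.sum_le_sum fun n _ => ?_)
    (sub_nonneg.2 (by exact_mod_cast hN)))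
  exact (hint n).2.trans_eq (hH n)

lemma entropyCost_le_bitCost (hp : p < Fintype.card 𝔽) : σ.entropyCost p ≤ σ.bitCost := by
  have := σ.isProbabilityMeasure_jointLaw hp
  rw [entropyCost, bitCost, Nat.cast_sum]
  refine Finset.sum_le_sum fun n _ => (entropy_le_logb_card fun a =>
    σ.measurable_A_joint n (measurableSet_singleton a)).trans_eq ?_
  simp [Real.logb_pow]

/-- The answers have total entropy at least `p * N / (N - 1)` bits. -/
lemma Achievable.ceil_le (h : σ.Achievable p) (hp : p < Fintype.card 𝔽) (hN : 2 ≤ N) {D : ℕ}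
    (hD : σ.entropyCost p ≤ D) : ⌈(p * N : ℚ) / (N - 1)⌉₊ ≤ D := by
  have hN' : (0 : ℝ) < N - 1 := by
    have : (2 : ℝ) ≤ N := by exact_mod_cast hN
    linarith
  have h1 : (p * N : ℝ) ≤ D * (N - 1) := by
    have h2 := h.mul_le_entropyCost hp (one_le_two.trans hN)
    have h3 := mul_le_mul_of_nonneg_left hD hN'.le
    linarith
  rw [Nat.ceil_le, div_le_iff₀ (by exact_mod_cast hN')]
  exact_mod_cast h1

end Scheme

/-! ### Uniform keys and one-time pads -/

/-- The uniform distribution on a finite type. -/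
noncomputable def unif (α : Type*) [Finite α] [Nonempty α] [MeasurableSpace α] : Measure α :=
  have := Fintype.ofFinite α
  (PMF.uniformOfFintype α).toMeasure

section

variable {α β γ : Type*} [MeasurableSpace α] [MeasurableSpace β] [MeasurableSpace γ]

instance [Finite α] [Nonempty α] : IsProbabilityMeasure (unif α) := by
  unfold unif; infer_instance

lemma map_add_right_unif [Finite α] [AddGroup α] [DiscreteMeasurableSpace α] (c : α) :
    (unif α).map (· + c) = unif α := by
  refine Measure.ext_of_singleton fun a => ?_
  have : (· + c) ⁻¹' {a} = {a - c} := by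
    ext x; exact eq_sub_iff_add_eq.symm
  rw [Measure.map_apply .of_discrete .of_discrete, this, unif,
    PMF.toMeasure_apply_singleton _ _ .of_discrete, PMF.toMeasure_apply_singleton _ _ .of_discrete]
  simp

/-- One-time pad: a uniform key stays uniform, and independent of `x`, after adding to it a
function of `x`. -/
lemma measurePreserving_add_unif [Finite γ] [AddGroup γ] [DiscreteMeasurableSpace γ]
    [DiscreteMeasurableSpace α] [Countable α] (μ : Measure α) [SFinite μ] (c : α → γ) :
    MeasurePreserving (fun x : α × γ => (x.1, x.2 + c x.1)) (μ.prod (unif γ))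
      (μ.prod (unif γ)) :=
  (MeasurePreserving.id μ).skew_product (g := fun x u => u + c x) .of_discrete
    (.of_forall fun x => map_add_right_unif (c x))

lemma indepFun_of_measurePreserving_prod {μ : Measure γ} [IsProbabilityMeasure μ]
    {ν₁ : Measure α} {ν₂ : Measure β} [IsProbabilityMeasure ν₁] [IsProbabilityMeasure ν₂]
    {X : γ → α} {Y : γ → β} (h : MeasurePreserving (fun x => (X x, Y x)) μ (ν₁.prod ν₂)) :
    IndepFun X Y μ := by
  have key : ∀ s t, MeasurableSet s → MeasurableSet t →
      μ (X ⁻¹' s ∩ Y ⁻¹' t) = ν₁ s * ν₂ t := fun s t hs ht => by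
    rw [← Measure.prod_prod, ← h.measure_preimage (hs.prod ht).nullMeasurableSet]
    rfl
  rw [indepFun_iff_measure_inter_preimage_eq_mul]
  intro s t hs ht
  have h1 := key s Set.univ hs .univ
  have h2 := key Set.univ t .univ ht
  simp only [Set.preimage_univ, Set.inter_univ, Set.univ_inter, measure_univ, mul_one,
    one_mul] at h1 h2
  rw [key s t hs ht, h1, h2]

lemma _root_.ProbabilityTheory.IndepFun.comp_measurePreserving {Ω Ω' : Type*} [MeasurableSpace Ω]
    [MeasurableSpace Ω'] {μ : Measure Ω} {ν : Measure Ω'} {T : Ω → Ω'}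
    (hT : MeasurePreserving T μ ν) {X : Ω' → α} {Y : Ω' → β} (hX : Measurable X)
    (hY : Measurable Y) (h : IndepFun X Y ν) :
    IndepFun (fun ω => X (T ω)) (fun ω => Y (T ω)) μ := by
  rw [indepFun_iff_measure_inter_preimage_eq_mul] at h ⊢
  intro s t hs ht
  have := h s t hs ht
  rw [← hT.measure_preimage (hX hs).nullMeasurableSet,
    ← hT.measure_preimage (hY ht).nullMeasurableSet,
    ← hT.measure_preimage ((hX hs).inter (hY ht)).nullMeasurableSet] at this
  exact this

/-- An independent variable may be adjoined to one side of an independence. -/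
lemma _root_.ProbabilityTheory.IndepFun.snd_prodMk_fst {Ω : Type*} [MeasurableSpace Ω]
    {ν : Measure Ω} [SFinite ν] {μ : Measure γ} [IsProbabilityMeasure μ] {X : Ω → α} {Y : Ω → β}
    (hX : Measurable X) (hY : Measurable Y) (h : IndepFun X Y ν) :
    IndepFun (fun z : γ × Ω => X z.2) (fun z => (z.1, Y z.2)) (μ.prod ν) := by
  have hX' : Measurable fun z : γ × Ω => X z.2 := hX.comp measurable_snd
  have hY' : Measurable fun z : γ × Ω => (z.1, Y z.2) :=
    measurable_fst.prodMk (hY.comp measurable_snd)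
  rw [indepFun_iff_measure_inter_preimage_eq_mul] at h ⊢
  intro s t hs ht
  have h1 : (μ.prod ν) ((fun z : γ × Ω => X z.2) ⁻¹' s) = ν (X ⁻¹' s) := by
    have : (fun z : γ × Ω => X z.2) ⁻¹' s = Set.univ ×ˢ (X ⁻¹' s) := by ext; simp
    rw [this, Measure.prod_prod, measure_univ, one_mul]
  rw [h1, Measure.prod_apply ((hX' hs).inter (hY' ht)), Measure.prod_apply (hY' ht),
    ← lintegral_const_mul _ (measurable_measure_prodMk_left (hY' ht))]
  exact lintegral_congr fun c => h s (Prod.mk c ⁻¹' t) hs (measurable_prodMk_left ht)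

end

/-! ### The retrieval scheme -/

/-- An allocation of the `p` elements of the initiator's set to databases and to `G` groups. Each
group uses one bit of common randomness and one side information bit downloaded from the database
`base`; within a group the elements are retrieved from distinct databases other than `base`. -/
structure Layout (p G N : ℕ) where
  /-- the database from which the `j`th element is retrieved -/
  db : Fin p → Fin N
  /-- the group of the `j`th element -/
  grp : Fin p → Fin G
  /-- the database that provides the side information -/
  base : Fin N
  db_ne_base : ∀ j, db j ≠ base
  injective : Function.Injective fun j => (db j, grp j)

namespace Layout

variable {p G N : ℕ} (L : Layout p G N)

/-- The database that answers for a slot, that is, for a downloaded bit: either the bit retrieving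
an element, or the side information bit of a group. -/
def slotDb : Fin p ⊕ Fin G → Fin N := Sum.elim L.db fun _ => L.base

/-- The group to which a downloaded bit belongs. -/
def slotGrp : Fin p ⊕ Fin G → Fin G := Sum.elim L.grp id

/-- The number of bits downloaded from the `n`th database. -/
def len (n : Fin N) : ℕ := Fintype.card {t // L.slotDb t = n}

/-- The group of the `i`th bit downloaded from the `n`th database. -/
noncomputable def group (n : Fin N) (i : Fin (L.len n)) : Fin G :=
  L.slotGrp ((Fintype.equivFin {t // L.slotDb t = n}).symm i).1

lemma injective_slot : Function.Injective fun t => (L.slotDb t, L.slotGrp t) := by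
  rintro (j | k) (j' | k') h <;> simp only [slotDb, slotGrp, Sum.elim_inl, Sum.elim_inr, id,
    Prod.mk.injEq] at h
  · exact congrArg _ (L.injective (Prod.ext h.1 h.2))
  · exact absurd h.1 (L.db_ne_base j)
  · exact absurd h.1.symm (L.db_ne_base j')
  · exact congrArg _ h.2

lemma injective_group (n : Fin N) : Function.Injective (L.group n) := fun i i' h => by
  have hdb : ∀ i, L.slotDb ((Fintype.equivFin {t // L.slotDb t = n}).symm i).1 = n := fun i =>
    ((Fintype.equivFin {t // L.slotDb t = n}).symm i).2
  refine (Fintype.equivFin {t // L.slotDb t = n}).symm.injective (Subtype.ext ?_)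
  exact L.injective_slot (Prod.ext ((hdb i).trans (hdb i').symm) h)

lemma exists_group_eq (t : Fin p ⊕ Fin G) :
    ∃ i : Fin (L.len (L.slotDb t)), L.group _ i = L.slotGrp t :=
  ⟨Fintype.equivFin {t' // L.slotDb t' = L.slotDb t} ⟨t, rfl⟩, by simp [group]⟩

lemma sum_len : ∑ n, L.len n = p + G := by
  simp only [len]
  rw [← Fintype.card_sigma, Fintype.card_congr (Equiv.sigmaFiberEquiv L.slotDb)]
  simp

end Layout

/-- With `M + 1` databases, `⌈p / M⌉` groups suffice. -/
lemma exists_layout (p : ℕ) {M : ℕ} (hM : 0 < M) :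
    Nonempty (Layout p ⌈(p / M : ℚ)⌉₊ (M + 1)) := by
  have hp : p ≤ ⌈(p / M : ℚ)⌉₊ * M := by
    have h := Nat.le_ceil (p / M : ℚ)
    rw [div_le_iff₀ (by exact_mod_cast hM)] at h
    exact_mod_cast h
  refine ⟨⟨fun j => Fin.succ ⟨j % M, Nat.mod_lt _ hM⟩,
    fun j => ⟨j / M, (Nat.div_lt_iff_lt_mul hM).2 (j.2.trans_le hp)⟩, 0,
    fun j => Fin.succ_ne_zero _, fun j j' h => ?_⟩⟩
  simp only [Prod.mk.injEq, Fin.succ_inj, Fin.mk.injEq] at h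
  ext
  rw [← Nat.div_add_mod j M, ← Nat.div_add_mod j' M, h.1, h.2]

section

variable {𝔽 : Type} {p G N : ℕ} (L : Layout p G N)

open Classical in
/-- The vector added to the key of group `k` in the query to the `n`th database, when `e`
enumerates the initiator's set: the unit vector of the element retrieved there, if any. -/
noncomputable def Layout.offset (e : Fin p → 𝔽) (n : Fin N) (k : Fin G) : 𝔽 → ZMod 2 :=
  ∑ j, if L.db j = n ∧ L.grp j = k then Pi.single (e j) 1 else 0

open Classical in
lemma Layout.offset_db_grp (e : Fin p → 𝔽) (j : Fin p) :
    L.offset e (L.db j) (L.grp j) = Pi.single (e j) 1 := by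
  rw [offset, Finset.sum_eq_single j]
  · simp
  · intro j' _ hj
    rw [if_neg]
    exact fun h => hj (L.injective (Prod.ext h.1 h.2))
  · simp

lemma Layout.offset_base (e : Fin p → 𝔽) (k : Fin G) : L.offset e L.base k = 0 := by
  simp [offset, L.db_ne_base]

lemma Layout.offset_apply_eq_zero (e : Fin p → 𝔽) (n : Fin N) (k : Fin G) {x : 𝔽}
    (hx : x ∉ Set.range e) : L.offset e n k x = 0 := by
  classical
  rw [offset, Finset.sum_apply]
  refine Finset.sum_eq_zero fun j _ => ?_
  split_ifs
  · exact Pi.single_eq_of_ne (fun h => hx ⟨j, h.symm⟩) _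
  · rfl

variable [Fintype 𝔽]

/-- The inner product over `𝔽₂` of `q` with the indicator vector of `r`. -/
noncomputable def parity (q : 𝔽 → ZMod 2) (r : Set 𝔽) : ZMod 2 := ∑ x, r.indicator q x

lemma parity_zero (r : Set 𝔽) : parity 0 r = 0 := by simp [parity]

lemma parity_add (q q' : 𝔽 → ZMod 2) (r : Set 𝔽) :
    parity (q + q') r = parity q r + parity q' r := by
  simp_rw [parity, ← Finset.sum_add_distrib]
  exact Finset.sum_congr rfl fun x _ => congrFun (Set.indicator_add r q q') x

lemma parity_inter {q : 𝔽 → ZMod 2} {P : Set 𝔽} (hq : ∀ x ∉ P, q x = 0) (r : Set 𝔽) :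
    parity q (r ∩ P) = parity q r := by
  refine Finset.sum_congr rfl fun x _ => ?_
  by_cases hr : x ∈ r <;> by_cases hP : x ∈ P <;> simp [hr, hP, hq]

lemma parity_single [DecidableEq 𝔽] (x : 𝔽) (r : Set 𝔽) :
    parity (Pi.single x 1) r = r.indicator 1 x := by
  rw [parity, Finset.sum_eq_single x]
  · by_cases hr : x ∈ r <;> simp [hr]
  · intro y _ hy
    simp [Set.indicator, hy]
  · simp

/-- The two elements of `ZMod 2` as bits. -/
def bit : ZMod 2 ≃ Bool := finTwoEquiv

/-- The scheme with the given layout. The initiator's private randomness is a uniform vector `h k`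
of `𝔽₂^𝔽` for each group `k`, the common randomness a uniform bit `s k` for each group. The bits
answered in group `k` are of the form `s k + ⟨q, r⟩`, where `q` is `h k` at the database `base`, and
`h k` plus the unit vector of the `j`th element at the database allocated to this element. -/
@[reducible]
noncomputable def Layout.scheme (e : Set 𝔽 → Fin p → 𝔽) : Scheme 𝔽 N where
  UserRand := Fin G → 𝔽 → ZMod 2
  CommonRand := Fin G → ZMod 2
  Query := Fin G → 𝔽 → ZMod 2
  userLaw := unif _
  commonLaw := unif _
  query n P h := h + L.offset (e P) n
  measurable_query _ := .of_discrete
  len := L.len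
  answer n q r s i := bit (s (L.group n i) + parity (q (L.group n i)) r)
  measurable_answer _ := .of_discrete

namespace Layout

variable {e : Set 𝔽 → Fin p → 𝔽}

lemma scheme_A (n : Fin N) (P : Set 𝔽) (ω : (L.scheme e).Outcome) (i : Fin (L.len n)) :
    (L.scheme e).A n P ω i = bit (ω.2.2 (L.group n i) + parity (ω.1 (L.group n i)) ω.2.1 +
      parity (L.offset (e P) n (L.group n i)) ω.2.1) := by
  rw [add_assoc, ← parity_add]
  rfl

lemma scheme_reliable (he : ∀ P, P.ncard = p → Set.range (e P) = P) :
    (L.scheme e).Reliable p := by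
  intro P hP
  have h1 : ∀ j, ∃ i : Fin (L.len (L.db j)), L.group _ i = L.grp j := fun j =>
    L.exists_group_eq (.inl j)
  have h2 : ∀ k, ∃ i : Fin (L.len L.base), L.group _ i = k := fun k =>
    L.exists_group_eq (.inr k)
  choose i hi using h1
  choose i' hi' using h2
  -- an element belongs to `R` when the bit retrieving it differs from the side information bit
  refine ⟨fun v => {x | ∃ j, e P j = x ∧
    v.2.2 (L.db j) (i j) ≠ v.2.2 L.base (i' (L.grp j))}, .of_discrete,
    .of_forall fun ω => ?_⟩
  have key : ∀ j, (L.scheme e).A (L.db j) P ω (i j) ≠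
      (L.scheme e).A L.base P ω (i' (L.grp j)) ↔ e P j ∈ ω.2.1 := fun j => by
    classical
    rw [scheme_A, scheme_A, hi, hi', bit.injective.ne_iff, offset_db_grp, offset_base, parity_zero,
      parity_single, (add_right_injective _).ne_iff]
    by_cases h : e P j ∈ ω.2.1 <;> simp [h]
  ext x
  constructor
  · rintro ⟨j, rfl, hj⟩
    exact ⟨(he P hP).subset (Set.mem_range_self j), (key j).1 hj⟩
  · rintro ⟨hx, hxR⟩
    rw [← he P hP] at hx
    obtain ⟨j, rfl⟩ := hx
    exact ⟨j, rfl, (key j).2 hxR⟩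

lemma scheme_initiatorPrivate (hp : p < Fintype.card 𝔽) : (L.scheme e).InitiatorPrivate p := by
  intro n
  have := isProbabilityMeasure_sizedSetLaw hp
  have := (L.scheme e).isProbabilityMeasure_jointLaw hp
  rw [mutualInfo_eq_zero_iff measurable_fst ((L.scheme e).measurable_Q_joint n)]
  exact indepFun_of_measurePreserving_prod
    ((measurePreserving_add_unif (sizedSetLaw 𝔽 p) fun P => L.offset (e P) n).comp
      ((MeasurePreserving.id _).prod measurePreserving_fst))

lemma scheme_responderPrivate (he : ∀ P, P.ncard = p → Set.range (e P) = P) :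
    (L.scheme e).ResponderPrivate p := by
  intro P hP
  have := (L.scheme e).isProbabilityMeasure_law
  rw [mutualInfo_eq_zero_iff .of_discrete ((L.scheme e).measurable_view P)]
  -- the key `h`, the side information bits `W = s + ⟨h, R⟩` and `R` are independent, and the view
  -- is a function of `h`, `W` and `R ∩ P`
  have hT : MeasurePreserving (fun ω : (L.scheme e).Outcome =>
      (ω.1, (ω.2.2 + fun k => parity (ω.1 k) ω.2.1), ω.2.1)) (L.scheme e).law
      ((unif (Fin G → 𝔽 → ZMod 2)).prod ((unif (Fin G → ZMod 2)).prod (setLaw 𝔽))) := by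
    refine (MeasurePreserving.id _).skew_product
      (g := fun (h : Fin G → 𝔽 → ZMod 2) (y : Set 𝔽 × (Fin G → ZMod 2)) =>
        ((y.2 + fun k => parity (h k) y.1), y.1)) .of_discrete
      (.of_forall fun (h : Fin G → 𝔽 → ZMod 2) => ?_)
    exact (Measure.measurePreserving_swap.comp (measurePreserving_add_unif (setLaw 𝔽)
      fun r (k : Fin G) => parity (h k) r)).map_eq
  have hind := ((((indepFun_sdiff_inter P).snd_prodMk_fst (μ := unif (Fin G → ZMod 2))
    .of_discrete .of_discrete).snd_prodMk_fst (μ := unif (Fin G → 𝔽 → ZMod 2))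
    .of_discrete .of_discrete).comp_measurePreserving hT .of_discrete .of_discrete).comp
    (φ := id) (ψ := fun z : (Fin G → 𝔽 → ZMod 2) × (Fin G → ZMod 2) × Set 𝔽 =>
      (z.1, (fun n => z.1 + L.offset (e P) n), fun n (i : Fin (L.len n)) =>
        bit (z.2.1 (L.group n i) + parity (L.offset (e P) n (L.group n i)) z.2.2)))
    measurable_id .of_discrete
  refine hind.congr .rfl (.of_forall fun ω => Eq.symm ?_)
  refine congrArg (Prod.mk _) (congrArg (Prod.mk _) ?_)
  funext n i
  refine (L.scheme_A n P ω i).trans ?_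
  simp only [Pi.add_apply]
  rw [parity_inter fun x hx => L.offset_apply_eq_zero (e P) n _ ((he P hP).symm ▸ hx)]

lemma scheme_achievable (hp : p < Fintype.card 𝔽)
    (he : ∀ P, P.ncard = p → Set.range (e P) = P) : (L.scheme e).Achievable p :=
  ⟨L.scheme_reliable he, L.scheme_initiatorPrivate hp, L.scheme_responderPrivate he⟩

lemma scheme_bitCost : (L.scheme e).bitCost = p + G := L.sum_len

/-- The answers are uniformly distributed, since the common randomness shifts them
transitively. -/
lemma scheme_entropyCost (hp : p < Fintype.card 𝔽) :
    (L.scheme e).entropyCost p = (p + G : ℕ) := by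
  have := isProbabilityMeasure_sizedSetLaw hp
  have := (L.scheme e).isProbabilityMeasure_jointLaw hp
  rw [Scheme.entropyCost, ← L.sum_len, Nat.cast_sum]
  refine Finset.sum_congr rfl fun n _ => ?_
  set X := fun x : Set 𝔽 × (L.scheme e).Outcome => (L.scheme e).A n x.1 x.2 with hX
  have hXm : ∀ a, MeasurableSet (X ⁻¹' {a}) := fun a => .of_discrete
  have hconst : ∀ a b, ((L.scheme e).jointLaw p).real (X ⁻¹' {a}) =
      ((L.scheme e).jointLaw p).real (X ⁻¹' {b}) := by
    intro a b
    obtain ⟨u, hu⟩ : ∃ u : Fin G → ZMod 2, ∀ i, u (L.group n i) =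
        bit.symm (b i) - bit.symm (a i) :=
      ⟨Function.extend (L.group n) (fun i => bit.symm (b i) - bit.symm (a i)) 0,
        fun i => (L.injective_group n).extend_apply _ _ _⟩
    have hT : MeasurePreserving (Prod.map id (Prod.map id (Prod.map id (· + u))))
        ((L.scheme e).jointLaw p) ((L.scheme e).jointLaw p) :=
      (MeasurePreserving.id _).prod ((MeasurePreserving.id _).prod
        ((MeasurePreserving.id _).prod ⟨.of_discrete, map_add_right_unif u⟩))
    rw [measureReal_def, measureReal_def, ← hT.measure_preimage (hXm b).nullMeasurableSet]
    congr 2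
    ext x
    simp only [Set.mem_preimage, Set.mem_singleton_iff, funext_iff, hX]
    refine forall_congr' fun i => ?_
    rw [scheme_A, scheme_A, ← Equiv.eq_symm_apply, ← Equiv.eq_symm_apply]
    simp only [Prod.map_fst, Prod.map_snd, id, Pi.add_apply, hu]
    constructor <;> intro h <;> linear_combination h
  refine entropy_eq_of_uniform hXm _ fun a => Or.inr ?_
  have h1 := sum_measureReal_preimage_singleton_eq_one (μ := (L.scheme e).jointLaw p) hXm
  rw [Finset.sum_congr rfl fun b _ => hconst b a] at h1
  simp only [Finset.sum_const, Finset.card_univ, Fintype.card_pi, Fintype.card_bool,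
    Finset.prod_const, Fintype.card_fin, nsmul_eq_mul, Nat.cast_pow, Nat.cast_ofNat] at h1
  exact eq_inv_of_mul_eq_one_right h1

end Layout

/-- An achievable scheme that attains the converse bound, for both download costs. -/
theorem exists_achievable {p N : ℕ} (hp : p < Fintype.card 𝔽) (hN : 2 ≤ N) :
    ∃ σ : Scheme 𝔽 N, σ.Achievable p ∧ σ.bitCost = ⌈(p * N : ℚ) / (N - 1)⌉₊ ∧
      σ.entropyCost p = (⌈(p * N : ℚ) / (N - 1)⌉₊ : ℕ) := by
  obtain ⟨M, rfl⟩ : ∃ M, N = M + 1 := ⟨N - 1, by omega⟩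
  have hM : 0 < M := by omega
  obtain ⟨L⟩ := exists_layout p hM
  have : Nonempty 𝔽 := Fintype.card_pos_iff.1 (by omega)
  have he : ∀ P : Set 𝔽, ∃ e : Fin p → 𝔽, P.ncard = p → Set.range e = P := fun P => by
    by_cases hP : P.ncard = p
    · have : Nat.card P = p := hP
      refine ⟨fun j => ((Finite.equivFinOfCardEq this).symm j).1, fun _ => ?_⟩
      ext x
      constructor
      · rintro ⟨j, rfl⟩
        exact Subtype.prop _
      · exact fun hx => ⟨Finite.equivFinOfCardEq this ⟨x, hx⟩, by simp⟩
    · exact ⟨fun _ => Classical.arbitrary 𝔽, fun h => absurd h hP⟩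
  choose e he using he
  have hceil : ⌈(p * (M + 1 : ℕ) : ℚ) / ((M + 1 : ℕ) - 1)⌉₊ = p + ⌈(p / M : ℚ)⌉₊ := by
    have hM' : (M : ℚ) ≠ 0 := by exact_mod_cast hM.ne'
    rw [add_comm p, ← Nat.ceil_add_natCast (by positivity)]
    congr 1
    push_cast
    rw [add_sub_cancel_right]
    field_simp
    ring
  exact ⟨L.scheme e, L.scheme_achievable hp he, by rw [L.scheme_bitCost, hceil],
    by rw [L.scheme_entropyCost hp, hceil]⟩

end

end PSI

theorem theorem1 (𝔽 : Type) [Fintype 𝔽] (P₁ P₂ N₁ N₂ : ℕ)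
    (hP₁ : P₁ < Fintype.card 𝔽) (hP₂ : P₂ < Fintype.card 𝔽) (hN₁ : 2 ≤ N₁) (hN₂ : 2 ≤ N₂) :
    IsLeast (PSI.bitCosts 𝔽 P₁ P₂ N₁ N₂)
        (min ⌈(P₁ * N₂ : ℚ) / (N₂ - 1)⌉₊ ⌈(P₂ * N₁ : ℚ) / (N₁ - 1)⌉₊) ∧
      IsLeast (PSI.entropyCosts 𝔽 P₁ P₂ N₁ N₂)
        (min ⌈(P₁ * N₂ : ℚ) / (N₂ - 1)⌉₊ ⌈(P₂ * N₁ : ℚ) / (N₁ - 1)⌉₊) := by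
  obtain ⟨σ₁, h₁, hb₁, he₁⟩ := PSI.exists_achievable hP₁ hN₂
  obtain ⟨σ₂, h₂, hb₂, he₂⟩ := PSI.exists_achievable hP₂ hN₁
  refine ⟨⟨?_, ?_⟩, ?_, ?_⟩
  · rcases min_choice ⌈(P₁ * N₂ : ℚ) / (N₂ - 1)⌉₊ ⌈(P₂ * N₁ : ℚ) / (N₁ - 1)⌉₊ with h | h <;> rw [h]
    · exact Or.inl ⟨σ₁, h₁, hb₁⟩
    · exact Or.inr ⟨σ₂, h₂, hb₂⟩
  · rintro D (⟨σ, h, rfl⟩ | ⟨σ, h, rfl⟩)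
    · exact min_le_of_left_le (h.ceil_le hP₁ hN₂ (PSI.Scheme.entropyCost_le_bitCost hP₁))
    · exact min_le_of_right_le (h.ceil_le hP₂ hN₁ (PSI.Scheme.entropyCost_le_bitCost hP₂))
  · rcases min_choice ⌈(P₁ * N₂ : ℚ) / (N₂ - 1)⌉₊ ⌈(P₂ * N₁ : ℚ) / (N₁ - 1)⌉₊ with h | h <;> rw [h]
    · exact Or.inl ⟨σ₁, h₁, he₁⟩
    · exact Or.inr ⟨σ₂, h₂, he₂⟩
  · rintro D (⟨σ, h, hD⟩ | ⟨σ, h, hD⟩)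
    · exact min_le_of_left_le (h.ceil_le hP₁ hN₂ hD.le)
    · exact min_le_of_right_le (h.ceil_le hP₂ hN₁ hD.le)
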